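/- A signed tree is a finite tree $T$ together with a sign $+$ or $-$ on each edge. The signed degree of a vertex is the number of positive edges incident to it minus the number of negative edges incident to it, and $(T,s)$ realizes a set $D$ of integers if $D$ is exactly the set of signed degrees of its vertices. If $D$ is realized by some signed tree, let $\operatorname{diam}(D)$ denote the minimum of the diameters of the trees $T$ over all signed trees $(T,s)$ realizing $D$. Theorem. Let $D=\{1,y_1,\dots,y_m,x_1,\dots,x_n\}$, where $m\ge 1$, $n\ge 0$, the $y_i$ are distinct integers with $y_i<-1$, and the $x_j$ are integers with $x_j>1$. Then both $D$ and $D\cup\{0\}$ are realized by signed trees, $\operatorname{diam}(D)=\operatorname{diam}(D\cup\{0\})$, and $$\operatorname{diam}(D)=\begin{cases}4 & \text{if } m=1,\\ 5 & \text{if } m=2,\\ 6 & \text{if } m>2.\end{cases}$$ -/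

import Mathlib

/-- A signed graph `(G, s)`: a simple graph together with a sign `+` (the unit `1`) or `-`
(the unit `-1`) on each of its edges. -/
structure SignedGraph (V : Type*) where
  graph : SimpleGraph V
  sign : graph.edgeSet → ℤˣ

namespace SignedGraph

/-- The signed degree of `v`: the number of positive edges incident to `v` minus the number of
negative edges incident to `v`. -/
noncomputable def sdeg {V : Type*} (S : SignedGraph V) (v : V) : ℤ :=
  ({e : S.graph.edgeSet | v ∈ (e : Sym2 V) ∧ S.sign e = 1}.ncard : ℤ) -
    ({e : S.graph.edgeSet | v ∈ (e : Sym2 V) ∧ S.sign e = -1}.ncard : ℤ)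

/-- `(G, s)` realizes `D`: its set of signed degrees is `D`. -/
def Realizes {V : Type*} (S : SignedGraph V) (D : Set ℤ) : Prop :=
  Set.range S.sdeg = D

/-- The set of all diameters of (the underlying trees of) finite signed trees realizing `D`. -/
def treeDiams (D : Set ℤ) : Set ℕ :=
  {d | ∃ (V : Type) (_ : Finite V) (S : SignedGraph V),
    S.graph.IsTree ∧ S.Realizes D ∧ S.graph.diam = d}

/-- The diameter of a set `D` of integers: the minimum diameter of a signed tree realizing `D`
(a genuine minimum as soon as some signed tree realizes `D`, that is, `treeDiams D` is
nonempty). -/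
noncomputable def setDiam (D : Set ℤ) : ℕ :=
  sInf (treeDiams D)

end SignedGraph

/-! Lower bound: -1 is not in the set, so the far end of a negative edge is never a leaf. A vertex
`a` of signed degree below -1 has two negative edges; in a tree at least one leads away from any
given `z`, and its far end has a further neighbour, at distance two more than `a`
(`exists_dist_eq_add_two`). Extending at both ends gives `dist a b + 4 ≤ diam`, and `m` distinct
vertices contain a pair at distance 0, 1 or 2. Upper bound (`exists_realizes_of_core`): start from a
core of diameter 0, 1 or 2 (point, edge, star), hang many negative pendants on it, then raise every
degree to its target with positive leaves. The leaves have degree 1 and the pendants take all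
nonnegative values, so including 0 changes nothing. -/

namespace SimpleGraph

/-! ### Distances in trees. -/

variable {V : Type*} {G : SimpleGraph V}

/-- Each of `v`, `w` is the penultimate vertex of a shortest path from `z` to `a`, and that path is
unique. -/
theorem IsTree.eq_of_adj_of_dist_lt (hG : G.IsTree) {z a v w : V} (hv : G.Adj v a)
    (hw : G.Adj w a) (hdv : G.dist z v < G.dist z a) (hdw : G.dist z w < G.dist z a) : v = w := by
  have key : ∀ u, G.Adj u a → G.dist z u < G.dist z a →
      ∃ p : G.Walk z a, p.IsPath ∧ p.penultimate = u := by
    intro u hu hd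
    obtain ⟨p, hp⟩ := hG.connected.exists_walk_length_eq_dist z u
    refine ⟨p.concat hu, Walk.isPath_of_length_eq_dist _ ?_, by simp⟩
    have := hG.dist_eq_dist_add_one_of_adj z hu
    rw [Walk.length_concat]
    omega
  obtain ⟨p, hp, rfl⟩ := key v hv hdv
  obtain ⟨q, hq, rfl⟩ := key w hw hdw
  rw [(hG.existsUnique_path z a).unique hp hq]

theorem IsTree.dist_eq_add_one_of_adj_of_ne (hG : G.IsTree) {z a v w : V} (hv : G.Adj v a)
    (hw : G.Adj w a) (hne : v ≠ w) (hdv : G.dist z v < G.dist z a) :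
    G.dist z w = G.dist z a + 1 := by
  have h1 := hG.dist_eq_dist_add_one_of_adj z hw
  have h2 := mt (hG.eq_of_adj_of_dist_lt hv hw hdv) hne
  omega

/-- Otherwise the three vertices form a triangle. -/
theorem IsTree.exists_dist_two_le_of_three (hG : G.IsTree) {u v w : V} (huv : u ≠ v)
    (huw : u ≠ w) (hvw : v ≠ w) : ∃ a ∈ ({u, v, w} : Set V), ∃ b ∈ ({u, v, w} : Set V),
      2 ≤ G.dist a b := by
  by_contra! h
  have hadj : ∀ a ∈ ({u, v, w} : Set V), ∀ b ∈ ({u, v, w} : Set V), a ≠ b → G.dist a b = 1 := by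
    intro a ha b hb hab
    have := h a ha b hb
    have := hG.connected.pos_dist_of_ne hab
    omega
  -- Adjacent vertices of a tree are never equidistant from a third vertex.
  refine hG.dist_ne_of_adj u (dist_eq_one_iff_adj.1 (hadj v (by simp) w (by simp) hvw)) ?_
  rw [hadj u (by simp) v (by simp) huv, hadj u (by simp) w (by simp) huw]

theorem Connected.dist_le_diam_of_finite [Finite V] (hG : G.Connected) (u v : V) :
    G.dist u v ≤ G.diam := by
  have := hG.nonempty
  exact dist_le_diam (connected_iff_ediam_ne_top.1 hG)

/-! ### Attaching pendant vertices. -/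

/-- The graph obtained from `G` by attaching, for each `w : W`, a pendant vertex to `a w`. -/
def attach (G : SimpleGraph V) {W : Type*} (a : W → V) : SimpleGraph (V ⊕ W) where
  Adj
    | .inl u, .inl v => G.Adj u v
    | .inl u, .inr w => a w = u
    | .inr w, .inl u => a w = u
    | .inr _, .inr _ => False
  symm := ⟨by
    rintro (u | u) (v | v) h
    · exact SimpleGraph.Adj.symm h
    all_goals exact h⟩
  loopless := ⟨by
    rintro (u | u) h
    · exact G.irrefl h
    · exact h⟩

section attach

variable {W : Type*} {a : W → V}

@[simp] theorem attach_adj_inl_inl {u v : V} :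
    (G.attach a).Adj (.inl u) (.inl v) ↔ G.Adj u v := Iff.rfl

@[simp] theorem attach_adj_inl_inr {u : V} {w : W} :
    (G.attach a).Adj (.inl u) (.inr w) ↔ a w = u := Iff.rfl

@[simp] theorem attach_adj_inr_inl {u : V} {w : W} :
    (G.attach a).Adj (.inr w) (.inl u) ↔ a w = u := Iff.rfl

@[simp] theorem attach_adj_inr_inr {w w' : W} :
    ¬ (G.attach a).Adj (.inr w) (.inr w') := id

/-- The inclusion of a graph into the graph with pendant vertices attached. -/
def attachHom (G : SimpleGraph V) (a : W → V) : G →g G.attach a where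
  toFun := Sum.inl
  map_rel' h := h

theorem Connected.attach (hG : G.Connected) : (G.attach a).Connected := by
  obtain ⟨r⟩ := hG.nonempty
  have hinl : ∀ u, (G.attach a).Reachable (.inl r) (.inl u) := fun u ↦
    (hG.preconnected r u).map (attachHom G a)
  refine (connected_iff_exists_forall_reachable _).2 ⟨.inl r, ?_⟩
  rintro (u | w)
  · exact hinl u
  · exact (hinl (a w)).trans (Adj.reachable (by simp))

theorem edgeSet_attach : (G.attach a).edgeSet =
    Sym2.map Sum.inl '' G.edgeSet ∪ Set.range fun w ↦ s(.inl (a w), .inr w) := by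
  ext e
  induction e with | _ x y
  rcases x with u | w <;> rcases y with v | w' <;>
    simp only [mem_edgeSet, Set.mem_union, Set.mem_image, Set.mem_range]
  · constructor
    · intro h
      exact .inl ⟨s(u, v), h, rfl⟩
    · rintro (⟨e, he, h⟩ | ⟨w, h⟩)
      · induction e with | _ u' v'
        simp only [Sym2.map_mk, Sym2.eq_iff, Sum.inl.injEq] at h
        rcases h with ⟨rfl, rfl⟩ | ⟨rfl, rfl⟩
        · exact he
        · exact SimpleGraph.Adj.symm he
      · simp at h
  · constructor
    · rintro rfl
      exact .inr ⟨w', rfl⟩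
    · rintro (⟨e, he, h⟩ | ⟨w, h⟩)
      · induction e with | _ u' v'
        simp at h
      · simp only [Sym2.eq_iff] at h
        simp at h
        rcases h with ⟨h, rfl⟩
        exact h
  · constructor
    · rintro rfl
      exact .inr ⟨w, Sym2.eq_swap⟩
    · rintro (⟨e, he, h⟩ | ⟨w, h⟩)
      · induction e with | _ u' v'
        simp at h
      · simp only [Sym2.eq_iff] at h
        simp at h
        rcases h with ⟨h, rfl⟩
        exact h
  · simp only [attach_adj_inr_inr, false_iff]
    rintro (⟨e, he, h⟩ | ⟨w, h⟩)
    · induction e with | _ u' v'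
      simp at h
    · simp at h

theorem card_edgeSet_attach [Finite V] [Finite W] :
    Nat.card (G.attach a).edgeSet = Nat.card G.edgeSet + Nat.card W := by
  rw [edgeSet_attach, Nat.card_coe_set_eq, Set.ncard_union_eq, Set.ncard_image_of_injective,
    ← Nat.card_coe_set_eq (Set.range _), Nat.card_range_of_injective, Nat.card_coe_set_eq]
  · intro w w' h
    exact (by simpa using h : a w = a w' ∧ w = w').2
  · exact Sym2.map.injective Sum.inl_injective
  · rw [Set.disjoint_left]
    rintro _ ⟨e, -, rfl⟩ ⟨w, h⟩
    induction e with | _ u v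
    simp at h

/-- Connectedness persists, and vertices and edges increase by the same number. -/
theorem IsTree.attach [Finite V] [Finite W] (hG : G.IsTree) : (G.attach a).IsTree := by
  rw [isTree_iff_connected_and_card] at hG ⊢
  refine ⟨hG.1.attach, ?_⟩
  rw [card_edgeSet_attach, Nat.card_sum, ← hG.2]
  omega

theorem Connected.dist_attach_le (hG : G.Connected) {d : ℕ} (hd : ∀ u v, G.dist u v ≤ d)
    (x y : V ⊕ W) : (G.attach a).dist x y ≤ d + 2 := by
  have hx : ∀ x : V ⊕ W, ∃ u : V, (G.attach a).dist x (.inl u) ≤ 1 := by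
    rintro (u | w)
    · exact ⟨u, by simp⟩
    · exact ⟨a w, (dist_eq_one_iff_adj.2 (by simp)).le⟩
  obtain ⟨u, hu⟩ := hx x
  obtain ⟨v, hv⟩ := hx y
  have huv : (G.attach a).dist (.inl u) (.inl v) ≤ d := by
    obtain ⟨p, hp⟩ := hG.exists_walk_length_eq_dist u v
    have := dist_le (p.map (attachHom G a))
    rw [Walk.length_map, hp] at this
    exact this.trans (hd u v)
  have hc : (G.attach a).Connected := hG.attach
  have h1 := hc.dist_triangle (u := x) (v := .inl u) (w := y)
  have h2 := hc.dist_triangle (u := .inl u) (v := .inl v) (w := y)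
  rw [dist_comm (u := .inl v) (v := y)] at h2
  omega

end attach

end SimpleGraph

/-! ### Signed degrees as sums of edge weights. -/

namespace SignedGraph

variable {V : Type*}

open scoped Classical in
/-- The entry of the signed adjacency matrix: the sign of the edge `uv`, or `0`. -/
noncomputable def weight (S : SignedGraph V) (u v : V) : ℤ :=
  if h : S.graph.Adj u v then (S.sign ⟨s(u, v), h⟩ : ℤ) else 0

theorem ncard_incident_sign (S : SignedGraph V) (v : V) (c : ℤˣ) :
    {e : S.graph.edgeSet | v ∈ (e : Sym2 V) ∧ S.sign e = c}.ncard =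
      {u : V | S.weight v u = c}.ncard := by
  symm
  have hc : (c : ℤ) ≠ 0 := c.ne_zero
  have hadj : ∀ u ∈ {u : V | S.weight v u = c}, ∃ h : S.graph.Adj v u,
      S.sign ⟨s(v, u), h⟩ = c := by
    intro u hu
    by_cases h : S.graph.Adj v u
    · refine ⟨h, ?_⟩
      simpa [weight, h, Units.val_inj] using hu
    · simp [weight, h, hc.symm] at hu
  refine Set.ncard_congr (fun u hu ↦ ⟨s(v, u), (hadj u hu).1⟩) ?_ ?_ ?_
  · intro u hu
    exact ⟨Sym2.mem_mk_left v u, (hadj u hu).2⟩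
  · intro u u' hu hu' h
    exact Sym2.congr_right.1 (Subtype.ext_iff.1 h)
  · rintro ⟨e, he⟩ ⟨hv, hs⟩
    obtain ⟨u, rfl⟩ := hv
    have he' : S.graph.Adj v u := he
    exact ⟨u, by simpa [weight, he', Units.val_inj] using hs, rfl⟩

theorem sdeg_eq_sum [Fintype V] (S : SignedGraph V) (v : V) : S.sdeg v = ∑ u, S.weight v u := by
  classical
  rw [sdeg, ncard_incident_sign, ncard_incident_sign, Set.ncard_eq_toFinset_card',
    Set.ncard_eq_toFinset_card', Set.toFinset_ofPred, Set.toFinset_ofPred, Finset.card_filter,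
    Finset.card_filter, Nat.cast_sum, Nat.cast_sum, ← Finset.sum_sub_distrib]
  refine Finset.sum_congr rfl fun u _ ↦ ?_
  by_cases h : S.graph.Adj v u
  · rcases Int.units_eq_one_or (S.sign ⟨s(v, u), h⟩) with h' | h' <;> simp [weight, h, h']
  · simp [weight, h]

section attach

variable {W : Type*}

open scoped Classical in
/-- Attach to a signed graph, for each `w : W`, a pendant vertex to `a w` along an edge of sign
`σ w`. -/
noncomputable def attach (S : SignedGraph V) (a : W → V) (σ : W → ℤˣ) : SignedGraph (V ⊕ W) where
  graph := S.graph.attach a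
  -- The formula covers all unordered pairs; the literal values `1` occur only at non-edges.
  sign e := Sym2.lift ⟨fun x y ↦ match x, y with
    | .inl u, .inl v => if h : S.graph.Adj u v then S.sign ⟨s(u, v), h⟩ else 1
    | .inl _, .inr w => σ w
    | .inr w, .inl _ => σ w
    | .inr _, .inr _ => 1, by
      rintro (u | u) (v | v) <;> simp [SimpleGraph.adj_comm, Sym2.eq_swap]⟩ (e : Sym2 (V ⊕ W))

variable (S : SignedGraph V) (a : W → V) (σ : W → ℤˣ)

@[simp] theorem weight_attach_inl_inl (u v : V) :
    (S.attach a σ).weight (.inl u) (.inl v) = S.weight u v := by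
  by_cases h : S.graph.Adj u v <;> simp [weight, attach, h]

open scoped Classical in
@[simp] theorem weight_attach_inl_inr (u : V) (w : W) :
    (S.attach a σ).weight (.inl u) (.inr w) = if a w = u then (σ w : ℤ) else 0 := by
  by_cases h : a w = u <;> simp [weight, attach, h]

open scoped Classical in
@[simp] theorem weight_attach_inr_inl (u : V) (w : W) :
    (S.attach a σ).weight (.inr w) (.inl u) = if a w = u then (σ w : ℤ) else 0 := by
  by_cases h : a w = u <;> simp [weight, attach, h]

@[simp] theorem weight_attach_inr_inr (w w' : W) :
    (S.attach a σ).weight (.inr w) (.inr w') = 0 := by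
  simp [weight, attach]

open scoped Classical in
theorem sdeg_attach_inl [Fintype V] [Fintype W] (v : V) :
    (S.attach a σ).sdeg (.inl v) = S.sdeg v + ∑ w, if a w = v then (σ w : ℤ) else 0 := by
  simp [sdeg_eq_sum]

theorem sdeg_attach_inr [Fintype V] [Fintype W] (w : W) :
    (S.attach a σ).sdeg (.inr w) = σ w := by
  classical
  simp [sdeg_eq_sum]

end attach

/-! ### Upper bound: extending a core. -/

/-- Attaching positive pendant vertices raises the signed degrees to any prescribed values. -/
theorem exists_attach_sdeg_eq {V : Type} [Finite V] (S : SignedGraph V) (T : V → ℤ)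
    (hT : ∀ v, S.sdeg v ≤ T v) : ∃ (W : Type) (_ : Finite W) (a : W → V) (σ : W → ℤˣ),
      (∀ v, (S.attach a σ).sdeg (.inl v) = T v) ∧ ∀ w, (S.attach a σ).sdeg (.inr w) = 1 := by
  classical
  have := Fintype.ofFinite V
  refine ⟨Σ v : V, Fin (T v - S.sdeg v).toNat, inferInstance, Sigma.fst, fun _ ↦ 1, ?_, ?_⟩
  · intro v
    rw [sdeg_attach_inl, Fintype.sum_sigma, Finset.sum_eq_single v]
    · simp [hT v]
    · intro b _ hb
      simp [hb]
    · simp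
  · intro w
    rw [sdeg_attach_inr, Units.val_one]

/-- A tree with vertices targeted at the values `t` extends to a signed tree realizing these values
and any finite set of nonnegative integers containing `1`, the diameter growing by at most `4`. -/
theorem exists_realizes_of_core {ι : Type} [Finite ι] (S : SignedGraph ι) (hS : S.graph.IsTree)
    {d : ℕ} (hd : ∀ u v, S.graph.dist u v ≤ d) (t : ι → ℤ) {L : Set ℤ} (hL : L.Finite)
    (h1 : 1 ∈ L) (h0 : ∀ l ∈ L, 0 ≤ l) : ∃ k ∈ treeDiams (Set.range t ∪ L), k ≤ d + 4 := by
  classical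
  have := Fintype.ofFinite ι
  have := hL.fintype
  obtain ⟨i₀⟩ := hS.connected.nonempty
  -- Large enough to push every core degree down to its target or below; the `+ 1` makes `Fin K`
  -- nonempty, so that each `l ∈ L` labels some pendant.
  let K : ℕ := ∑ i, (S.sdeg i - t i).toNat + 1
  have hK : ∀ i, S.sdeg i - t i ≤ K := fun i ↦ by
    have : (S.sdeg i - t i).toNat ≤ ∑ i, (S.sdeg i - t i).toNat :=
      Finset.single_le_sum (f := fun i ↦ (S.sdeg i - t i).toNat) (fun _ _ ↦ Nat.zero_le _)
        (Finset.mem_univ i)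
    omega
  let B := ι × L × Fin K
  let S₁ : SignedGraph (ι ⊕ B) := S.attach (W := B) Prod.fst fun _ ↦ -1
  let T : ι ⊕ B → ℤ := Sum.elim t fun b ↦ (b.2.1 : ℤ)
  have hT : ∀ v, S₁.sdeg v ≤ T v := by
    rintro (i | b)
    · have hs : S₁.sdeg (.inl i) = S.sdeg i - Fintype.card L * K := by
        rw [sdeg_attach_inl, Fintype.sum_prod_type, Finset.sum_eq_single i]
        · simp [sub_eq_add_neg]
        · intro b _ hb
          simp [hb]
        · simp
      have hcard : (1 : ℤ) ≤ Fintype.card L := by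
        exact_mod_cast Fintype.card_pos_iff.2 (⟨⟨1, h1⟩⟩ : Nonempty L)
      have : (K : ℤ) ≤ Fintype.card L * K := le_mul_of_one_le_left (by positivity) hcard
      have := hK i
      rw [hs]
      change _ ≤ t i
      linarith
    -- A negative pendant starts at -1, below its nonnegative target.
    · rw [sdeg_attach_inr]
      have := h0 _ b.2.1.2
      change _ ≤ (b.2.1 : ℤ)
      simp only [Units.val_neg, Units.val_one]
      linarith
  obtain ⟨W, _, a, σ, hV, hW⟩ := exists_attach_sdeg_eq S₁ T hT
  have hK0 : 0 < K := Nat.succ_pos _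
  have htree₁ : S₁.graph.IsTree := hS.attach
  have htree : (S₁.attach a σ).graph.IsTree := htree₁.attach
  refine ⟨_, ⟨_, inferInstance, S₁.attach a σ, htree, ?_, rfl⟩, ?_⟩
  · apply Set.Subset.antisymm
    · rintro _ ⟨(v | w), rfl⟩
      · rw [hV]
        rcases v with i | b
        · exact .inl ⟨i, rfl⟩
        · exact .inr b.2.1.2
      · rw [hW]
        exact .inr h1
    · rintro _ (⟨i, rfl⟩ | hl)
      · exact ⟨.inl (.inl i), hV _⟩
      · exact ⟨.inl (.inr ((i₀, ⟨_, hl⟩, ⟨0, hK0⟩) : B)), hV _⟩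
  · have := htree.connected.nonempty
    obtain ⟨u, v, huv⟩ := (S₁.attach a σ).graph.exists_dist_eq_diam
    rw [← huv]
    exact htree₁.connected.dist_attach_le (hS.connected.dist_attach_le hd) u v

/-! ### Lower bound: leaving vertices of negative degree. -/

theorem exists_adj_of_sdeg_ne_neg_one {S : SignedGraph V} {u v : V} (hw : S.weight v u = -1)
    (hv : S.sdeg v ≠ -1) : ∃ w ≠ u, S.graph.Adj w v := by
  by_contra! h
  have hz : ∀ w, w ≠ u → S.weight v w = 0 := fun w hwu ↦ by
    have h' : ¬ S.graph.Adj v w := fun h' ↦ h w hwu h'.symm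
    simp [weight, h']
  apply hv
  -- If `u` were the only neighbour, `v` would be a leaf on a negative edge.
  have e1 : {w | S.weight v w = ((1 : ℤˣ) : ℤ)} = ∅ := by
    ext w
    by_cases hwu : w = u
    · simp [hwu, hw]
    · simp [hz w hwu]
  have e2 : {w | S.weight v w = ((-1 : ℤˣ) : ℤ)} = {u} := by
    ext w
    by_cases hwu : w = u
    · simp [hwu, hw]
    · simp [hz w hwu, hwu]
  rw [sdeg, ncard_incident_sign, ncard_incident_sign, e1, e2]
  simp

theorem weight_comm (S : SignedGraph V) (u v : V) : S.weight u v = S.weight v u := by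
  by_cases h : S.graph.Adj u v
  · simp [weight, h, h.symm, Sym2.eq_swap]
  · simp [weight, h, mt SimpleGraph.Adj.symm h]

theorem adj_of_weight_ne_zero {S : SignedGraph V} {u v : V} (h : S.weight u v ≠ 0) :
    S.graph.Adj u v := by
  by_contra h'
  simp [weight, h'] at h

theorem exists_two_weight_eq_neg_one [Finite V] {S : SignedGraph V} {v : V}
    (hv : S.sdeg v < -1) : ∃ u w, S.weight v u = -1 ∧ S.weight v w = -1 ∧ u ≠ w := by
  have : 1 < {u | S.weight v u = ((-1 : ℤˣ) : ℤ)}.ncard := by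
    rw [sdeg, ncard_incident_sign, ncard_incident_sign] at hv
    omega
  obtain ⟨u, hu, w, hw, huw⟩ := (Set.one_lt_ncard).1 this
  exact ⟨u, w, hu, hw, huw⟩

/-- From a vertex of signed degree less than `-1` one can move two steps away from any vertex. -/
theorem exists_dist_eq_add_two [Finite V] {S : SignedGraph V} (hS : S.graph.IsTree)
    (hneg : ∀ v, S.sdeg v ≠ -1) {a : V} (ha : S.sdeg a < -1) (z : V) :
    ∃ b, S.graph.dist z b = S.graph.dist z a + 2 := by
  obtain ⟨v, hv, hd⟩ : ∃ v, S.weight a v = -1 ∧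
      S.graph.dist z v = S.graph.dist z a + 1 := by
    obtain ⟨u, w, hu, hw, huw⟩ := exists_two_weight_eq_neg_one ha
    have hu' := (adj_of_weight_ne_zero (hu.trans_ne (by simp))).symm
    have hw' := (adj_of_weight_ne_zero (hw.trans_ne (by simp))).symm
    -- At most one neighbour of `a` is closer to `z`, so if `u` is, then `w` is not.
    rcases hS.dist_eq_dist_add_one_of_adj z hu' with h | h
    · exact ⟨u, hu, h⟩
    · exact ⟨w, hw, hS.dist_eq_add_one_of_adj_of_ne hu' hw' huw (by omega)⟩
  have hadj := adj_of_weight_ne_zero (hv.trans_ne (by simp))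
  rw [weight_comm] at hv
  obtain ⟨b, hb, hbv⟩ := exists_adj_of_sdeg_ne_neg_one hv (hneg v)
  refine ⟨b, ?_⟩
  rw [hS.dist_eq_add_one_of_adj_of_ne hadj hbv hb.symm (by omega), hd]

theorem dist_add_four_le_diam [Finite V] {S : SignedGraph V} (hS : S.graph.IsTree)
    (hneg : ∀ v, S.sdeg v ≠ -1) {a b : V} (ha : S.sdeg a < -1) (hb : S.sdeg b < -1) :
    S.graph.dist a b + 4 ≤ S.graph.diam := by
  obtain ⟨a', ha'⟩ := exists_dist_eq_add_two hS hneg ha b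
  -- Moving away from `a'` rather than from `a` makes the two extensions add up.
  obtain ⟨b', hb'⟩ := exists_dist_eq_add_two hS hneg hb a'
  have := hS.connected.dist_le_diam_of_finite a' b'
  rw [SimpleGraph.dist_comm (u := a') (v := b)] at hb'
  rw [SimpleGraph.dist_comm (u := a) (v := b)]
  omega

theorem le_of_mem_treeDiams {m : ℕ} (hm : 1 ≤ m) {y : Fin m → ℤ} (hy_inj : Function.Injective y)
    (hy : ∀ i, y i < -1) {D : Set ℤ} (hyD : Set.range y ⊆ D) (hD : -1 ∉ D) {k : ℕ}
    (hk : k ∈ treeDiams D) : (if m = 1 then 4 else if m = 2 then 5 else 6) ≤ k := by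
  obtain ⟨V, _, S, hS, rfl, rfl⟩ := hk
  have hneg : ∀ v, S.sdeg v ≠ -1 := fun v hv ↦ hD ⟨v, hv⟩
  choose v hv using fun i ↦ hyD ⟨i, rfl⟩
  have hv_inj : Function.Injective v := fun i j h ↦ hy_inj (by rw [← hv, ← hv, h])
  have hlow : ∀ i j, S.graph.dist (v i) (v j) + 4 ≤ S.graph.diam := fun i j ↦
    dist_add_four_le_diam hS hneg (by rw [hv]; exact hy i) (by rw [hv]; exact hy j)
  split_ifs with h1 h2
  · have := hlow ⟨0, hm⟩ ⟨0, hm⟩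
    omega
  · have hne : v ⟨0, by omega⟩ ≠ v ⟨1, by omega⟩ := hv_inj.ne (by simp)
    have := hS.connected.pos_dist_of_ne hne
    have := hlow ⟨0, by omega⟩ ⟨1, by omega⟩
    omega
  · obtain ⟨a, ha, b, hb, hab⟩ := hS.exists_dist_two_le_of_three
      (u := v ⟨0, by omega⟩) (v := v ⟨1, by omega⟩) (w := v ⟨2, by omega⟩)
      (hv_inj.ne (by simp)) (hv_inj.ne (by simp)) (hv_inj.ne (by simp))
    have hr : ∀ a ∈ ({v ⟨0, by omega⟩, v ⟨1, by omega⟩, v ⟨2, by omega⟩} : Set V),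
        ∃ i, v i = a := by
      rintro a (rfl | rfl | rfl) <;> exact ⟨_, rfl⟩
    obtain ⟨i, rfl⟩ := hr a ha
    obtain ⟨j, rfl⟩ := hr b hb
    have := hlow i j
    omega

/-! ### Choice of the core and the exact minimum. -/

theorem exists_mem_treeDiams_le {m : ℕ} (hm : 1 ≤ m) (y : Fin m → ℤ) {L : Set ℤ}
    (hL : L.Finite) (h1 : 1 ∈ L) (h0 : ∀ l ∈ L, 0 ≤ l) :
    ∃ k ∈ treeDiams (Set.range y ∪ L), k ≤ if m = 1 then 4 else if m = 2 then 5 else 6 := by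
  have : Nonempty (Fin m) := ⟨⟨0, hm⟩⟩
  split_ifs with hm1 hm2
  · have : Subsingleton (Fin m) := by subst hm1; infer_instance
    exact exists_realizes_of_core (d := 0) ⟨⊥, fun _ ↦ 1⟩ SimpleGraph.IsTree.of_subsingleton
      (by simp) y hL h1 h0
  · refine exists_realizes_of_core (d := 1) ⟨⊤, fun _ ↦ 1⟩
      ⟨SimpleGraph.connected_top, SimpleGraph.IsAcyclic.of_card_le_two (by simp [hm2])⟩ ?_
      y hL h1 h0
    intro u v
    rw [SimpleGraph.dist_top]
    split_ifs <;> simp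
  -- The core is a star whose leaves have targets `y i`; its centre has target 1, which already lies
  -- in `L`.
  · let P : SignedGraph Unit := ⟨⊥, fun _ ↦ 1⟩
    have hP : P.graph.IsTree := SimpleGraph.IsTree.of_subsingleton
    have hPd : ∀ u v, P.graph.dist u v ≤ 0 := by simp [P]
    obtain ⟨k, hk, hk6⟩ := exists_realizes_of_core (d := 2)
      (P.attach (W := Fin m) (fun _ ↦ ()) fun _ ↦ 1) hP.attach
      (fun u v ↦ hP.connected.dist_attach_le hPd u v) (Sum.elim (fun _ ↦ 1) y) hL h1 h0
    refine ⟨k, ?_, hk6⟩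
    convert hk using 2
    rw [Set.Sum.elim_range, Set.range_const, Set.union_right_comm, Set.singleton_union,
      Set.insert_eq_of_mem h1, Set.union_comm]

theorem isLeast_treeDiams {m : ℕ} (hm : 1 ≤ m) {y : Fin m → ℤ} (hy_inj : Function.Injective y)
    (hy : ∀ i, y i < -1) {L : Set ℤ} (hL : L.Finite) (h1 : 1 ∈ L) (h0 : ∀ l ∈ L, 0 ≤ l) :
    IsLeast (treeDiams (Set.range y ∪ L)) (if m = 1 then 4 else if m = 2 then 5 else 6) := by
  have hlow : ∀ k ∈ treeDiams (Set.range y ∪ L), _ ≤ k := fun k hk ↦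
    le_of_mem_treeDiams hm hy_inj hy Set.subset_union_left (by
      rintro (⟨i, hi⟩ | h)
      · have := hy i
        omega
      · have := h0 _ h
        omega) hk
  obtain ⟨k, hk, hle⟩ := exists_mem_treeDiams_le hm y hL h1 h0
  rw [le_antisymm (hlow k hk) hle]
  exact ⟨hk, fun j hj ↦ hle.trans (hlow j hj)⟩

end SignedGraph

theorem mainTheorem3 (m n : ℕ) (hm : 1 ≤ m) (y : Fin m → ℤ) (x : Fin n → ℤ)
    (hy_inj : Function.Injective y) (hy : ∀ i, y i < -1) (hx : ∀ j, 1 < x j)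
    (D : Set ℤ) (hD : D = {1} ∪ Set.range y ∪ Set.range x) :
    IsLeast (SignedGraph.treeDiams D) (SignedGraph.setDiam D) ∧
    IsLeast (SignedGraph.treeDiams (D ∪ {0})) (SignedGraph.setDiam (D ∪ {0})) ∧
    SignedGraph.setDiam D = SignedGraph.setDiam (D ∪ {0}) ∧
    SignedGraph.setDiam D = (if m = 1 then 4 else if m = 2 then 5 else 6) := by
  have hfin : (Set.range x).Finite := Set.finite_range x
  have e1 : D = Set.range y ∪ ({1} ∪ Set.range x) := by
    rw [hD, Set.union_comm {1}, Set.union_assoc]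
  have e2 : D ∪ {0} = Set.range y ∪ ({1} ∪ Set.range x ∪ {0}) := by
    rw [e1, Set.union_assoc]
  have hx0 : ∀ l ∈ {1} ∪ Set.range x, 0 ≤ l := by
    rintro l (rfl | ⟨j, rfl⟩)
    · simp
    · have := hx j
      omega
  have l1 := SignedGraph.isLeast_treeDiams hm hy_inj hy (L := {1} ∪ Set.range x)
    ((Set.finite_singleton 1).union hfin) (by simp) hx0
  have l2 := SignedGraph.isLeast_treeDiams hm hy_inj hy (L := {1} ∪ Set.range x ∪ {0})
    (((Set.finite_singleton 1).union hfin).union (Set.finite_singleton 0)) (by simp) (by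
      rintro l (h | rfl)
      · exact hx0 l h
      · exact le_rfl)
  rw [← e1] at l1
  rw [← e2] at l2
  have s1 : SignedGraph.setDiam D = _ := l1.csInf_eq
  have s2 : SignedGraph.setDiam (D ∪ {0}) = _ := l2.csInf_eq
  rw [s1, s2]
  exact ⟨l1, l2, rfl, rfl⟩
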